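/- Let $N\ge 1$ be an integer, $s\in(0,1)$ and $\alpha<2s$. There is a constant $\Lambda$, depending only on $N$, $s$ and $\alpha$, such that the following holds. Let $\rho\in C(\mathbb R^N)$ with $\rho>0$ and, for some $K>0$, $$\rho(x)\ \ge\ K(1+|x|^2)^{-\alpha/2}\qquad\text{for all }x\in\mathbb R^N,$$ and let $c\in C(\mathbb R^N)$ with $c\ge 0$ and, for some $c_0>0$, $c(x)\ge c_0$ for all $x\in\mathbb R^N$. Let $\mathcal L^s(\mathbb R^N)$ be the set of measurable $v:\mathbb R^N\to\mathbb R$ with $\int_{\mathbb R^N}\frac{|v(x)|}{1+|x|^{N+2s}}\,dx<\infty$. Let $u$ be a solution of $$(-\Delta)^s u+\rho c u=0\quad\text{in }\mathbb R^N,$$ that is: $u\in\mathcal L^s(\mathbb R^N)$; for some $\gamma>0$, $u\in C^{2s+\gamma}_{loc}(\mathbb R^N)$ if $s<\tfrac12$ (with $2s+\gamma\le 1$), and $u\in C^{1,2s+\gamma-1}_{loc}(\mathbb R^N)$ if $s\ge\tfrac12$ (with $2s+\gamma-1\le1$); and, for every $x\in\mathbb R^N$, $$C_{N,s}\,\mathrm{P.V.}\!\int_{\mathbb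 R^N}\frac{u(x)-u(y)}{|x-y|^{N+2s}}\,dy+\rho(x)c(x)u(x)=0,\qquad C_{N,s}=\frac{2^{2s-1}\,2s\,\Gamma((N+2s)/2)}{\pi^{N/2}\,\Gamma(1-s)}.$$ Suppose that $|u|^p\in\mathcal L^s(\mathbb R^N)$ for some $p\ge1$ and that $p\,c_0K>\Lambda$. If, for some $\sigma\in(0,2s-\alpha)$ and $C>0$, $$|u(x)|\le C(1+|x|^2)^{\sigma/2}\qquad\text{for all }x\in\mathbb R^N,$$ then $u\equiv0$ in $\mathbb R^N$. -/

import Mathlib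

open MeasureTheory Filter Topology
open scoped NNReal

namespace FracElliptic

/-- The weighted space `𝓛ˢ(ℝᴺ)`: measurable functions with
`∫ |u(x)| / (1 + |x|^(N+2s)) dx < ∞`. -/
def MemLs (N : ℕ) (s : ℝ) (u : EuclideanSpace ℝ (Fin N) → ℝ) : Prop :=
  Measurable u ∧
    Integrable (fun x : EuclideanSpace ℝ (Fin N) => |u x| / (1 + ‖x‖ ^ ((N : ℝ) + 2 * s))) volume

/-- Hölder continuity with exponent `θ` on every compact set. -/
def LocallyHolder {E F : Type*} [NormedAddCommGroup E] [NormedAddCommGroup F]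
    (θ : ℝ≥0) (f : E → F) : Prop :=
  ∀ S : Set E, IsCompact S → ∃ L : ℝ≥0, HolderOnWith L θ f S

/-- The local regularity class for the pointwise fractional Laplacian of order `s`, for some
`γ > 0`: `C_loc^{2s+γ}` if `s < 1/2` (here `θ = 2s+γ ≤ 1`), and `C_loc^{1,2s+γ-1}` if `s ≥ 1/2`
(here `θ = 2s+γ-1 ≤ 1`). -/
def FracRegular (N : ℕ) (s : ℝ) (u : EuclideanSpace ℝ (Fin N) → ℝ) : Prop :=
  (s < 1 / 2 → ∃ θ : ℝ≥0, 2 * s < (θ : ℝ) ∧ θ ≤ 1 ∧ LocallyHolder θ u) ∧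
  (1 / 2 ≤ s → ContDiff ℝ 1 u ∧
    ∃ θ : ℝ≥0, 2 * s - 1 < (θ : ℝ) ∧ θ ≤ 1 ∧ LocallyHolder θ (fderiv ℝ u))

/-- The normalization constant
`C_{N,s} = 2^(2s-1) 2s Γ((N+2s)/2) / (π^(N/2) Γ(1-s))` of the fractional Laplacian. -/
noncomputable def fracConst (N : ℕ) (s : ℝ) : ℝ :=
  (2 : ℝ) ^ (2 * s - 1) * (2 * s) * Real.Gamma (((N : ℝ) + 2 * s) / 2) /
    (Real.pi ^ ((N : ℝ) / 2) * Real.Gamma (1 - s))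

/-- The integrand `(u(x) - u(y)) / |x - y|^(N+2s)`, as a function of `y`. -/
noncomputable def fracIntegrand (N : ℕ) (s : ℝ) (u : EuclideanSpace ℝ (Fin N) → ℝ)
    (x y : EuclideanSpace ℝ (Fin N)) : ℝ :=
  (u x - u y) / ‖x - y‖ ^ ((N : ℝ) + 2 * s)

/-- `HasFracLaplacianAt N s u x h`: the principal value
`C_{N,s} P.V. ∫ (u(x) - u(y)) / |x - y|^(N+2s) dy` exists and equals `h`, that is, the integrals
over the complements of the balls `B(x, ε)` converge absolutely and, multiplied by `C_{N,s}`, tend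
to `h` as `ε → 0⁺`. -/
def HasFracLaplacianAt (N : ℕ) (s : ℝ) (u : EuclideanSpace ℝ (Fin N) → ℝ)
    (x : EuclideanSpace ℝ (Fin N)) (h : ℝ) : Prop :=
  (∀ ε : ℝ, 0 < ε → IntegrableOn (fracIntegrand N s u x) (Metric.ball x ε)ᶜ volume) ∧
    Tendsto (fun ε : ℝ => fracConst N s * ∫ y in (Metric.ball x ε)ᶜ, fracIntegrand N s u x y)
      (𝓝[>] 0) (𝓝 h)

/-- `u` is a (pointwise) solution of `(-Δ)ˢ u + ρ c u = 0` in `ℝᴺ`. -/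
structure IsSolution (N : ℕ) (s : ℝ) (ρ c u : EuclideanSpace ℝ (Fin N) → ℝ) : Prop where
  memLs : MemLs N s u
  regular : FracRegular N s u
  equation : ∀ x, ∃ h : ℝ, HasFracLaplacianAt N s u x h ∧ h + ρ x * c x * u x = 0

end FracElliptic

/-! Growth below `2 * s - α` already forces decay. Suppose `u x₀ > 0` with `‖x₀‖ = R` large. On the
ball of radius `R / 2` about `x₀`, `u` is at most of order `R ^ σ`, so a paraboloid of opening of
order `R ^ (σ - 2)` touches `u` from above at a nearby `x₁` with `u x₀ ≤ u x₁`
(`exists_touching_paraboloid`). Touching bounds the fractional Laplacian at `x₁` below by minus a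
multiple of `R ^ (σ - 2 * s)` plus the tail `R ^ e` (`HasFracLaplacianAt.ge_of_touching`). Since `ρ
* c` is at least of order `R ^ (-α)`, the equation yields `u x₀ ≲ R ^ (σ - 2 * s + α) + R ^ (e + α)`
(`exists_le_rpow_of_growth`). Both exponents are negative, so a positive value of `u` would produce
a positive global maximum, where the equation fails (`nonpos_of_decay`). The same holds for `-u`. -/

namespace FracElliptic

open Metric Module
open scoped Pointwise RealInnerProductSpace

/-! ### Integrability and scaling of powers of the norm. -/

section PowerIntegrals

variable {E : Type*} [NormedAddCommGroup E] [InnerProductSpace ℝ E] [FiniteDimensional ℝ E]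
  [MeasurableSpace E] [BorelSpace E]

theorem integrableOn_norm_rpow_ball [Nontrivial E] {b r : ℝ} (hb : -(finrank ℝ E : ℝ) < b)
    (hr : 0 < r) : IntegrableOn (fun z : E => ‖z‖ ^ b) (ball 0 r) := by
  rw [integrableOn_fun_norm_addHaar volume (f := fun t : ℝ => t ^ b)]
  have h := (intervalIntegral.integrableOn_Ioo_rpow_iff (s := (finrank ℝ E : ℝ) - 1 + b) hr).2
    (by linarith)
  refine h.congr_fun (fun t ht => ?_) measurableSet_Ioo
  have hpos : 0 < finrank ℝ E := finrank_pos
  simp only [smul_eq_mul]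
  rw [Real.rpow_add ht.1, ← Real.rpow_natCast, Nat.cast_sub hpos, Nat.cast_one]

theorem integrableOn_norm_rpow_compl_ball [Nontrivial E] {b r : ℝ}
    (hb : b < -(finrank ℝ E : ℝ)) (hr : 0 < r) :
    IntegrableOn (fun z : E => ‖z‖ ^ b) (ball 0 r)ᶜ := by
  rw [← integrable_indicator_iff measurableSet_ball.compl]
  have hpos : 0 < finrank ℝ E := finrank_pos
  have key : Integrable (fun z : E => (Set.Ici r).indicator (fun t : ℝ => t ^ b) ‖z‖) := by
    rw [integrable_fun_norm_addHaar volume (f := (Set.Ici r).indicator (fun t : ℝ => t ^ b))]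
    have h := integrableOn_Ioi_rpow_of_lt (a := (finrank ℝ E : ℝ) - 1 + b) (by linarith) hr
    rw [← integrableOn_Ici_iff_integrableOn_Ioi] at h
    have h' := (integrable_indicator_iff measurableSet_Ici).2 h
    refine (h'.integrableOn (s := Set.Ioi 0)).congr_fun (fun t ht => ?_) measurableSet_Ioi
    by_cases htr : t ∈ Set.Ici r
    · simp only [Set.indicator_of_mem htr, smul_eq_mul]
      rw [Real.rpow_add ht, ← Real.rpow_natCast, Nat.cast_sub hpos, Nat.cast_one]
    · simp [Set.indicator_of_notMem htr]
  refine key.congr (Eventually.of_forall fun z => ?_)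
  by_cases hz : r ≤ ‖z‖
  · dsimp only
    rw [Set.indicator_of_mem (show ‖z‖ ∈ Set.Ici r from hz), Set.indicator_of_mem (by simpa using hz)]
  · dsimp only
    rw [Set.indicator_of_notMem (show ‖z‖ ∉ Set.Ici r from hz),
      Set.indicator_of_notMem (by simpa using hz)]

theorem setIntegral_norm_rpow_smul (S : Set E) (b : ℝ) {r : ℝ} (hr : 0 < r) :
    ∫ z in r • S, ‖z‖ ^ b = r ^ ((finrank ℝ E : ℝ) + b) * ∫ z in S, ‖z‖ ^ b := by
  have h := Measure.setIntegral_comp_smul_of_pos volume (fun z : E => ‖z‖ ^ b) S hr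
  have h2 : ∀ z : E, ‖r • z‖ ^ b = r ^ b * ‖z‖ ^ b := fun z => by
    rw [norm_smul, Real.norm_of_nonneg hr.le, Real.mul_rpow hr.le (norm_nonneg _)]
  simp only [h2, integral_const_mul, smul_eq_mul] at h
  rw [Real.rpow_add hr, Real.rpow_natCast, mul_assoc, h, ← mul_assoc,
    mul_inv_cancel₀ (by positivity), one_mul]

theorem setIntegral_ball_norm_rpow (b : ℝ) {r : ℝ} (hr : 0 < r) :
    ∫ z in ball (0 : E) r, ‖z‖ ^ b =
      r ^ ((finrank ℝ E : ℝ) + b) * ∫ z in ball (0 : E) 1, ‖z‖ ^ b := by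
  rw [← setIntegral_norm_rpow_smul _ b hr, smul_unitBall_of_pos hr]

theorem setIntegral_compl_ball_norm_rpow (b : ℝ) {r : ℝ} (hr : 0 < r) :
    ∫ z in (ball (0 : E) r)ᶜ, ‖z‖ ^ b =
      r ^ ((finrank ℝ E : ℝ) + b) * ∫ z in (ball (0 : E) 1)ᶜ, ‖z‖ ^ b := by
  have h : r • (ball (0 : E) 1)ᶜ = (ball (0 : E) r)ᶜ := by
    rw [← smul_unitBall_of_pos hr]
    exact Set.smul_set_compl (a := Units.mk0 r hr.ne')
  rw [← setIntegral_norm_rpow_smul _ b hr, h]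

theorem setIntegral_add_left (x : E) (S : Set E) (f : E → ℝ) :
    ∫ z in (fun z => x + z) ⁻¹' S, f (x + z) = ∫ y in S, f y :=
  (measurePreserving_add_left volume x).setIntegral_preimage_emb
    (MeasurableEquiv.addLeft x).measurableEmbedding f S

theorem integrableOn_add_left_iff (x : E) (S : Set E) (f : E → ℝ) :
    IntegrableOn (fun z => f (x + z)) ((fun z => x + z) ⁻¹' S) ↔ IntegrableOn f S :=
  (measurePreserving_add_left volume x).integrableOn_comp_preimage
    (MeasurableEquiv.addLeft x).measurableEmbedding

theorem add_preimage_ball {E : Type*} [NormedAddCommGroup E] (x : E) (r : ℝ) :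
    (fun z => x + z) ⁻¹' (ball x r) = ball 0 r := by
  ext z; simp

/-- Over an annulus centred at the origin the odd part of the integrand cancels. -/
theorem setIntegral_annulus_le [Nontrivial E] (w : E) {q ε r : ℝ} (hε : 0 < ε) (hεr : ε < r)
    (hq : q < (finrank ℝ E : ℝ) + 2) :
    IntegrableOn (fun z : E => (2 * ⟪w, z⟫ + ‖z‖ ^ 2) / ‖z‖ ^ q) (ball 0 r \ ball 0 ε) ∧
    ∫ z in ball (0 : E) r \ ball 0 ε, (2 * ⟪w, z⟫ + ‖z‖ ^ 2) / ‖z‖ ^ q ≤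
      ∫ z in ball (0 : E) r, ‖z‖ ^ (2 - q) := by
  set T : Set E := ball 0 r \ ball 0 ε with hT
  have hTm : MeasurableSet T := measurableSet_ball.diff measurableSet_ball
  have hpos : ∀ z ∈ T, 0 < ‖z‖ := fun z hz => by
    have h2 := hz.2
    simp only [mem_ball, dist_zero_right, not_lt] at h2
    linarith
  have h1 : IntegrableOn (fun z : E => 2 * ⟪w, z⟫ / ‖z‖ ^ q) T := by
    have hc : ContinuousOn (fun z : E => 2 * ⟪w, z⟫ / ‖z‖ ^ q) (closedBall 0 r \ ball 0 ε) := by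
      have hne : ∀ z ∈ closedBall (0 : E) r \ ball 0 ε, ‖z‖ ≠ 0 := fun z hz => by
        have h2 := hz.2
        simp only [mem_ball, dist_zero_right, not_lt] at h2
        linarith
      refine ContinuousOn.div (by fun_prop)
        (continuous_norm.continuousOn.rpow_const fun z hz => Or.inl (hne z hz)) fun z hz => ?_
      have := (hne z hz).symm.lt_of_le (norm_nonneg z)
      positivity
    exact (hc.integrableOn_compact ((isCompact_closedBall 0 r).diff isOpen_ball)).mono_set
      (Set.sdiff_subset_sdiff_left ball_subset_closedBall)
  have h2 : IntegrableOn (fun z : E => ‖z‖ ^ (2 - q)) (ball 0 r) :=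
    integrableOn_norm_rpow_ball (by linarith) (hε.trans hεr)
  have hsplit : ∀ z ∈ T, 2 * ⟪w, z⟫ / ‖z‖ ^ q + ‖z‖ ^ (2 - q) =
      (2 * ⟪w, z⟫ + ‖z‖ ^ 2) / ‖z‖ ^ q := fun z hz => by
    rw [Real.rpow_sub (hpos z hz), Real.rpow_two, add_div]
  have h2T := h2.mono_set (Set.sdiff_subset : T ⊆ _)
  have hodd : ∫ z in T, 2 * ⟪w, z⟫ / ‖z‖ ^ q = 0 := by
    have h := integral_neg_eq_self (T.indicator fun z : E => 2 * ⟪w, z⟫ / ‖z‖ ^ q) volume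
    have h' : (fun z : E => T.indicator (fun z : E => 2 * ⟪w, z⟫ / ‖z‖ ^ q) (-z)) =
        fun z => -(T.indicator (fun z : E => 2 * ⟪w, z⟫ / ‖z‖ ^ q) z) := by
      funext z
      have hz : -z ∈ T ↔ z ∈ T := by simp [hT]
      by_cases hzT : z ∈ T
      · rw [Set.indicator_of_mem hzT, Set.indicator_of_mem (hz.2 hzT)]
        simp [inner_neg_right, neg_div]
      · rw [Set.indicator_of_notMem hzT, Set.indicator_of_notMem (mt hz.1 hzT), neg_zero]
    rw [h', integral_neg, integral_indicator hTm] at h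
    linarith
  refine ⟨(h1.add h2T).congr_fun hsplit hTm, ?_⟩
  rw [← setIntegral_congr_fun hTm hsplit, integral_add h1 h2T, hodd, zero_add]
  -- Enlarging the annulus to the ball makes the bound independent of `ε`.
  exact setIntegral_mono_set h2 (Eventually.of_forall fun z => by positivity)
    (Set.sdiff_subset.eventuallyLE)

end PowerIntegrals

/-! ### Bounds on the fractional Laplacian at a point, and on its tails. -/

section Touching

variable {N : ℕ} {s : ℝ} {u : EuclideanSpace ℝ (Fin N) → ℝ}

theorem fracConst_pos (hs0 : 0 < s) (hs1 : s < 1) : 0 < fracConst N s := by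
  have h1 : 0 < Real.Gamma (((N : ℝ) + 2 * s) / 2) := Real.Gamma_pos_of_pos (by positivity)
  have h2 : 0 < Real.Gamma (1 - s) := Real.Gamma_pos_of_pos (by linarith)
  have := Real.pi_pos
  unfold fracConst
  positivity

/-- A paraboloid touching `u` from above at `x` in a ball bounds the truncated integrals of
the fractional Laplacian of `u` at `x` from below. -/
theorem le_setIntegral_fracIntegrand_of_touching (hN : 1 ≤ N) (hs1 : s < 1)
    {x w : EuclideanSpace ℝ (Fin N)} {A F ε r : ℝ} (hε : 0 < ε) (hεr : ε < r) (hA : 0 ≤ A)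
    (hux : 0 ≤ u x)
    (hint : ∀ ε : ℝ, 0 < ε → IntegrableOn (fracIntegrand N s u x) (ball x ε)ᶜ)
    (htouch : ∀ z ∈ ball (0 : EuclideanSpace ℝ (Fin N)) r,
      u (x + z) ≤ u x + A * (2 * ⟪w, z⟫ + ‖z‖ ^ 2))
    (htail : IntegrableOn (fun y => |u y| / ‖x - y‖ ^ ((N : ℝ) + 2 * s)) (ball x r)ᶜ)
    (hF : ∫ y in (ball x r)ᶜ, |u y| / ‖x - y‖ ^ ((N : ℝ) + 2 * s) ≤ F) :
    -(A * (r ^ (2 - 2 * s) *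
      ∫ z in ball (0 : EuclideanSpace ℝ (Fin N)) 1, ‖z‖ ^ (2 - ((N : ℝ) + 2 * s)))) - F ≤
      ∫ y in (ball x ε)ᶜ, fracIntegrand N s u x y := by
  have : Nonempty (Fin N) := ⟨⟨0, hN⟩⟩
  have hfr : (finrank ℝ (EuclideanSpace ℝ (Fin N)) : ℝ) = N := by simp
  have hset : (ball x ε)ᶜ = (ball x r \ ball x ε) ∪ (ball x r)ᶜ := by
    ext y
    simp only [Set.mem_compl_iff, Set.mem_union, Set.mem_sdiff, mem_ball]
    constructor
    · intro h; by_cases h' : dist y x < r <;> simp [h, h']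
    · rintro (h | h)
      · exact h.2
      · linarith
  have hnear_int : IntegrableOn (fracIntegrand N s u x) (ball x r \ ball x ε) :=
    (hint ε hε).mono_set (by rw [hset]; exact Set.subset_union_left)
  have hfar_int := hint r (hε.trans hεr)
  rw [hset, setIntegral_union (disjoint_compl_right.mono_left Set.sdiff_subset)
    measurableSet_ball.compl hnear_int hfar_int]
  have hfar : -F ≤ ∫ y in (ball x r)ᶜ, fracIntegrand N s u x y := by
    -- Far away, `u x ≥ 0` is dropped, so only the tail of `|u|` counts.
    have h : ∫ y in (ball x r)ᶜ, -(|u y| / ‖x - y‖ ^ ((N : ℝ) + 2 * s)) ≤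
        ∫ y in (ball x r)ᶜ, fracIntegrand N s u x y := by
      refine setIntegral_mono htail.neg hfar_int fun y => ?_
      simp only [fracIntegrand, ← neg_div]
      have := le_abs_self (u y)
      gcongr
      linarith
    rw [integral_neg] at h
    linarith
  have hT : (fun z => x + z) ⁻¹' (ball x r \ ball x ε) = ball 0 r \ ball 0 ε := by
    rw [Set.preimage_sdiff, add_preimage_ball, add_preimage_ball]
  obtain ⟨hI, hle⟩ := setIntegral_annulus_le (E := EuclideanSpace ℝ (Fin N)) w hε hεr
    (q := (N : ℝ) + 2 * s) (by rw [hfr]; linarith)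
  rw [setIntegral_ball_norm_rpow _ (hε.trans hεr), hfr,
    show (N : ℝ) + (2 - (N + 2 * s)) = 2 - 2 * s by ring] at hle
  have hnear : -A * ∫ z in ball (0 : EuclideanSpace ℝ (Fin N)) r \ ball 0 ε,
      (2 * ⟪w, z⟫ + ‖z‖ ^ 2) / ‖z‖ ^ ((N : ℝ) + 2 * s) ≤
      ∫ y in ball x r \ ball x ε, fracIntegrand N s u x y := by
    rw [← setIntegral_add_left x (ball x r \ ball x ε), hT, ← integral_const_mul]
    have hI' := (integrableOn_add_left_iff x _ _).2 hnear_int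
    rw [hT] at hI'
    refine setIntegral_mono_on (hI.const_mul _) hI'
      (measurableSet_ball.diff measurableSet_ball) fun z hz => ?_
    have := htouch z hz.1
    simp only [fracIntegrand, sub_add_cancel_left, norm_neg]
    rw [← mul_div_assoc]
    gcongr
    linarith
  nlinarith [mul_le_mul_of_nonneg_left hle hA]

/-- The bound on the truncated integrals is uniform in `ε < r`, hence survives the principal-value
limit. -/
theorem HasFracLaplacianAt.ge_of_touching (hN : 1 ≤ N) (hs0 : 0 < s) (hs1 : s < 1)
    {x w : EuclideanSpace ℝ (Fin N)} {A F r h : ℝ} (hh : HasFracLaplacianAt N s u x h)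
    (hr : 0 < r) (hA : 0 ≤ A) (hux : 0 ≤ u x)
    (htouch : ∀ z ∈ ball (0 : EuclideanSpace ℝ (Fin N)) r,
      u (x + z) ≤ u x + A * (2 * ⟪w, z⟫ + ‖z‖ ^ 2))
    (htail : IntegrableOn (fun y => |u y| / ‖x - y‖ ^ ((N : ℝ) + 2 * s)) (ball x r)ᶜ)
    (hF : ∫ y in (ball x r)ᶜ, |u y| / ‖x - y‖ ^ ((N : ℝ) + 2 * s) ≤ F) :
    fracConst N s * (-(A * (r ^ (2 - 2 * s) *
      ∫ z in ball (0 : EuclideanSpace ℝ (Fin N)) 1, ‖z‖ ^ (2 - ((N : ℝ) + 2 * s)))) - F) ≤ h := by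
  refine ge_of_tendsto hh.2 ?_
  filter_upwards [Ioo_mem_nhdsGT hr] with ε hε
  exact mul_le_mul_of_nonneg_left (le_setIntegral_fracIntegrand_of_touching hN hs1 hε.1 hε.2 hA
    hux hh.1 htouch htail hF) (fracConst_pos hs0 hs1).le

theorem HasFracLaplacianAt.nonneg_of_isMax (hs0 : 0 < s) (hs1 : s < 1)
    {x : EuclideanSpace ℝ (Fin N)} {h : ℝ} (hh : HasFracLaplacianAt N s u x h)
    (hmax : ∀ y, u y ≤ u x) : 0 ≤ h := by
  refine ge_of_tendsto hh.2 (Eventually.of_forall fun ε => ?_)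
  refine mul_nonneg (fracConst_pos hs0 hs1).le (integral_nonneg fun y => ?_)
  exact div_nonneg (sub_nonneg.2 (hmax y)) (by positivity)

theorem HasFracLaplacianAt.neg {x : EuclideanSpace ℝ (Fin N)} {h : ℝ}
    (hh : HasFracLaplacianAt N s u x h) : HasFracLaplacianAt N s (fun y => -u y) x (-h) := by
  have heq : fracIntegrand N s (fun y => -u y) x = fun y => -fracIntegrand N s u x y := by
    funext y
    simp only [fracIntegrand, ← neg_div]
    ring
  refine ⟨fun ε hε => ?_, ?_⟩
  · rw [heq]
    exact (hh.1 ε hε).neg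
  · simpa only [heq, integral_neg, mul_neg] using hh.2.neg

theorem FracRegular.continuous (hs0 : 0 < s) (h : FracRegular N s u) : Continuous u := by
  rcases lt_or_ge s (1 / 2) with hs | hs
  · obtain ⟨θ, hθ, -, hu⟩ := h.1 hs
    have hθ0 : 0 < θ := by
      have : (0 : ℝ) < θ := by linarith
      exact_mod_cast this
    rw [continuous_iff_continuousAt]
    intro x
    obtain ⟨L, hL⟩ := hu _ (isCompact_closedBall x 1)
    exact (hL.continuousOn hθ0).continuousAt (closedBall_mem_nhds x one_pos)
  · exact (h.2 hs).1.continuous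

/-- The tail integrals of a function of `𝓛ˢ` are bounded at distance comparable to the centre. -/
theorem MemLs.tail_le (hs0 : 0 < s) (hu : MemLs N s u) {x : EuclideanSpace ℝ (Fin N)} {r : ℝ}
    (hr : 1 ≤ r) (hx : ‖x‖ ≤ 5 * r) :
    IntegrableOn (fun y => |u y| / ‖x - y‖ ^ ((N : ℝ) + 2 * s)) (ball x r)ᶜ ∧
    ∫ y in (ball x r)ᶜ, |u y| / ‖x - y‖ ^ ((N : ℝ) + 2 * s) ≤
      (1 + 6 ^ ((N : ℝ) + 2 * s)) * ∫ y, |u y| / (1 + ‖y‖ ^ ((N : ℝ) + 2 * s)) := by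
  set q : ℝ := (N : ℝ) + 2 * s with hq
  have hq0 : 0 < q := by positivity
  have hle : ∀ y ∈ (ball x r)ᶜ, |u y| / ‖x - y‖ ^ q ≤
      (1 + 6 ^ q) * (|u y| / (1 + ‖y‖ ^ q)) := fun y hy => by
    have hd : r ≤ ‖x - y‖ := by
      rw [← dist_eq_norm, dist_comm]; simpa using hy
    -- `6 = 5 + 1`, from `‖x‖ ≤ 5 * r ≤ 5 * ‖x - y‖`.
    have hy6 : ‖y‖ ≤ 6 * ‖x - y‖ := by
      have := norm_sub_norm_le y x
      rw [norm_sub_rev] at this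
      linarith
    have h1 : (1 : ℝ) ≤ ‖x - y‖ ^ q := Real.one_le_rpow (hr.trans hd) hq0.le
    have h2 : ‖y‖ ^ q ≤ 6 ^ q * ‖x - y‖ ^ q := by
      rw [← Real.mul_rpow (by norm_num) (norm_nonneg _)]
      exact Real.rpow_le_rpow (norm_nonneg _) hy6 hq0.le
    rw [← mul_div_assoc, div_le_div_iff₀ (by linarith) (by positivity)]
    nlinarith [mul_le_mul_of_nonneg_left (show 1 + ‖y‖ ^ q ≤ (1 + 6 ^ q) * ‖x - y‖ ^ q by
      linarith) (abs_nonneg (u y))]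
  have hG : Integrable (fun y => (1 + 6 ^ q) * (|u y| / (1 + ‖y‖ ^ q))) := hu.2.const_mul _
  have hI : IntegrableOn (fun y => |u y| / ‖x - y‖ ^ q) (ball x r)ᶜ := by
    refine hG.integrableOn.mono' ?_ ?_
    · have := hu.1
      exact Measurable.aestronglyMeasurable (by fun_prop)
    · refine (ae_restrict_iff' measurableSet_ball.compl).2 (Eventually.of_forall fun y hy => ?_)
      rw [Real.norm_of_nonneg (by positivity)]
      exact hle y hy
  refine ⟨hI, (setIntegral_mono_on hI hG.integrableOn measurableSet_ball.compl hle).trans ?_⟩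
  rw [← integral_const_mul]
  exact setIntegral_le_integral hG (Eventually.of_forall fun y => by positivity)

/-- The tail integrals of a function of growth `σ < 2s` decay at distance comparable to the
centre. -/
theorem tail_le_of_growth (hN : 1 ≤ N) (hu : Measurable u) {σ C : ℝ} (hσ0 : 0 < σ)
    (hσ : σ < 2 * s) (hC : 0 < C) (hgrowth : ∀ x, |u x| ≤ C * (1 + ‖x‖ ^ 2) ^ (σ / 2))
    {x : EuclideanSpace ℝ (Fin N)} {r : ℝ} (hr : 1 ≤ r) (hx : ‖x‖ ≤ 5 * r) :
    IntegrableOn (fun y => |u y| / ‖x - y‖ ^ ((N : ℝ) + 2 * s)) (ball x r)ᶜ ∧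
    ∫ y in (ball x r)ᶜ, |u y| / ‖x - y‖ ^ ((N : ℝ) + 2 * s) ≤
      (C * 7 ^ σ * ∫ z in (ball (0 : EuclideanSpace ℝ (Fin N)) 1)ᶜ, ‖z‖ ^ (σ - ((N : ℝ) + 2 * s))) *
        r ^ (σ - 2 * s) := by
  have : Nonempty (Fin N) := ⟨⟨0, hN⟩⟩
  have hfr : (finrank ℝ (EuclideanSpace ℝ (Fin N)) : ℝ) = N := by simp
  have hr0 : 0 < r := by linarith
  set q : ℝ := (N : ℝ) + 2 * s with hq
  have hle : ∀ y ∈ (ball x r)ᶜ, |u y| / ‖x - y‖ ^ q ≤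
      C * 7 ^ σ * ‖y - x‖ ^ (σ - q) := fun y hy => by
    rw [norm_sub_rev]
    have hd : r ≤ ‖y - x‖ := by
      rw [← dist_eq_norm]; simpa using hy
    have hy6 : ‖y‖ ≤ 6 * ‖y - x‖ := by
      have := norm_sub_norm_le y x
      linarith
    have hd0 : 0 < ‖y - x‖ := by linarith
    -- As `‖y - x‖ ≥ 1`, the base is at most `(1 + 6 ^ 2) * ‖y - x‖ ^ 2`, and `37 ≤ 7 ^ 2`.
    have h1 : (1 + ‖y‖ ^ 2) ^ (σ / 2) ≤ (7 * ‖y - x‖) ^ σ := by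
      calc (1 + ‖y‖ ^ 2) ^ (σ / 2) ≤ ((7 * ‖y - x‖) ^ 2) ^ (σ / 2) := by
            refine Real.rpow_le_rpow (by positivity) ?_ (by positivity)
            nlinarith [norm_nonneg y]
        _ = (7 * ‖y - x‖) ^ σ := by
            rw [← Real.rpow_two, ← Real.rpow_mul (by positivity)]
            congr 1; ring
    rw [Real.rpow_sub hd0, ← mul_div_assoc, mul_assoc, ← Real.mul_rpow (by norm_num) hd0.le]
    gcongr
    exact (hgrowth y).trans (by gcongr)
  have hpre : (fun z => x + z) ⁻¹' (ball x r)ᶜ = (ball 0 r)ᶜ := by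
    rw [Set.preimage_compl, add_preimage_ball]
  have hP : IntegrableOn (fun y => ‖y - x‖ ^ (σ - q)) (ball x r)ᶜ := by
    rw [← integrableOn_add_left_iff x, hpre]
    simpa only [add_sub_cancel_left] using
      integrableOn_norm_rpow_compl_ball (E := EuclideanSpace ℝ (Fin N)) (b := σ - q)
        (by rw [hfr]; linarith) hr0
  have hG := hP.const_mul (C * 7 ^ σ)
  have hI : IntegrableOn (fun y => |u y| / ‖x - y‖ ^ q) (ball x r)ᶜ := by
    refine Integrable.mono' hG ?_ ?_
    · exact Measurable.aestronglyMeasurable (by fun_prop)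
    · refine (ae_restrict_iff' measurableSet_ball.compl).2 (Eventually.of_forall fun y hy => ?_)
      rw [Real.norm_of_nonneg (by positivity)]
      exact hle y hy
  refine ⟨hI, (setIntegral_mono_on hI hG measurableSet_ball.compl hle).trans (le_of_eq ?_)⟩
  rw [integral_const_mul, ← setIntegral_add_left x, hpre]
  simp only [add_sub_cancel_left]
  rw [setIntegral_compl_ball_norm_rpow _ hr0, hfr,
    show (N : ℝ) + (σ - q) = σ - 2 * s by rw [hq]; ring]
  ring

end Touching

/-! ### Decay at infinity and the maximum principle. -/

section Liouville

variable {N : ℕ} {s : ℝ} {u : EuclideanSpace ℝ (Fin N) → ℝ}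

/-- The worst endpoint is `2 * R` for `α ≥ 0` and `R / 2` for `α ≤ 0`; `|α|` covers both signs. -/
theorem two_rpow_mul_rpow_le {α R t : ℝ} (hR : 0 < R) (h1 : R / 2 ≤ t) (h2 : t ≤ 2 * R) :
    2 ^ (-|α|) * R ^ (-α) ≤ t ^ (-α) := by
  have ht : 0 < t := by linarith
  rcases le_total 0 α with hα | hα
  · rw [abs_of_nonneg hα, ← Real.mul_rpow (by norm_num) hR.le]
    exact Real.rpow_le_rpow_of_nonpos ht h2 (by linarith)
  · rw [abs_of_nonpos hα, neg_neg, ← inv_inv ((2 : ℝ) ^ α), ← Real.rpow_neg (by norm_num),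
      ← Real.inv_rpow (by norm_num), ← Real.mul_rpow (by norm_num) hR.le]
    exact Real.rpow_le_rpow (by positivity) (by linarith) (by linarith)

/-- If `u ≤ M` on `closedBall x₀ (R / 2)` then some paraboloid of opening `16 M / R²` touches `u`
from above at a point close to `x₀`. -/
theorem exists_touching_paraboloid {u : EuclideanSpace ℝ (Fin N) → ℝ} (hu : Continuous u)
    {x₀ : EuclideanSpace ℝ (Fin N)} {M R : ℝ} (hR0 : 0 < R) (hM0 : 0 < M) (hu0 : 0 < u x₀)
    (hbound : ∀ y ∈ closedBall x₀ (R / 2), u y ≤ M) :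
    ∃ x₁ : EuclideanSpace ℝ (Fin N), ‖x₁ - x₀‖ < R / 4 ∧ u x₀ ≤ u x₁ ∧
      ∀ z ∈ ball (0 : EuclideanSpace ℝ (Fin N)) (R / 4),
        u (x₁ + z) ≤ u x₁ + 16 * M / R ^ 2 * (2 * ⟪x₁ - x₀, z⟫ + ‖z‖ ^ 2) := by
  obtain ⟨A, hA⟩ : ∃ A : ℝ, A = 16 * M / R ^ 2 := ⟨_, rfl⟩
  have hA0 : 0 < A := by rw [hA]; positivity
  rw [← hA]
  obtain ⟨x₁, hx₁, hmax⟩ := (isCompact_closedBall x₀ (R / 2)).exists_isMaxOn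
    ⟨x₀, mem_closedBall_self (by positivity)⟩
    (f := fun y => u y - A * ‖y - x₀‖ ^ 2) (by fun_prop)
  have hv : u x₀ ≤ u x₁ - A * ‖x₁ - x₀‖ ^ 2 := by
    have h : u x₀ - A * ‖x₀ - x₀‖ ^ 2 ≤ u x₁ - A * ‖x₁ - x₀‖ ^ 2 :=
      hmax (mem_closedBall_self (by positivity))
    simpa using h
  have hclose : ‖x₁ - x₀‖ < R / 4 := by
    -- The opening is chosen so that at distance `R / 4` the penalty reaches `M`; the penalised
    -- function is then at most `0`, below its value `u x₀ > 0` at the centre.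
    by_contra! hcon
    have h1 : M ≤ A * ‖x₁ - x₀‖ ^ 2 := by
      calc M = A * (R / 4) ^ 2 := by rw [hA]; field_simp; norm_num
        _ ≤ _ := by gcongr
    linarith [hbound x₁ hx₁]
  refine ⟨x₁, hclose, hv.trans (by linarith [mul_nonneg hA0.le (sq_nonneg ‖x₁ - x₀‖)]),
    fun z hz => ?_⟩
  have hz' : ‖z‖ < R / 4 := by simpa using hz
  have hsum : x₁ + z - x₀ = (x₁ - x₀) + z := by abel
  have hmem : x₁ + z ∈ closedBall x₀ (R / 2) := by
    rw [mem_closedBall, dist_eq_norm, hsum]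
    exact (norm_add_le _ _).trans (by linarith)
  have h1 : u (x₁ + z) - A * ‖x₁ + z - x₀‖ ^ 2 ≤ u x₁ - A * ‖x₁ - x₀‖ ^ 2 := hmax hmem
  rw [hsum, norm_add_sq_real] at h1
  linarith

theorem le_of_growth_of_norm_le {σ C R : ℝ} (hσ : 0 < σ) (hC : 0 < C) (hR : 2 ≤ R)
    (hgrowth : ∀ x, |u x| ≤ C * (1 + ‖x‖ ^ 2) ^ (σ / 2)) {y : EuclideanSpace ℝ (Fin N)}
    (hy : ‖y‖ ≤ 3 * R / 2) : u y ≤ C * 2 ^ σ * R ^ σ := by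
  refine (le_abs_self _).trans ((hgrowth y).trans ?_)
  rw [mul_assoc, ← Real.mul_rpow (by norm_num) (by linarith)]
  refine mul_le_mul_of_nonneg_left ?_ hC.le
  calc (1 + ‖y‖ ^ 2) ^ (σ / 2) ≤ ((2 * R) ^ 2) ^ (σ / 2) := by
        refine Real.rpow_le_rpow (by positivity) ?_ (by positivity)
        nlinarith [norm_nonneg y]
    _ = (2 * R) ^ σ := by
        rw [← Real.rpow_two, ← Real.rpow_mul (by linarith)]
        congr 1; ring

theorem mul_rpow_le_of_norm {V : EuclideanSpace ℝ (Fin N) → ℝ} {K α R : ℝ} (hK : 0 < K)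
    (hV : ∀ x, K * (1 + ‖x‖ ^ 2) ^ (-(α / 2)) ≤ V x) (hR : 4 ≤ R)
    {x : EuclideanSpace ℝ (Fin N)} (h1 : 3 * R / 4 ≤ ‖x‖) (h2 : ‖x‖ ≤ 5 * (R / 4)) :
    K * 2 ^ (-|α|) * R ^ (-α) ≤ V x := by
  refine le_trans ?_ (hV x)
  have ht : 0 < 1 + ‖x‖ ^ 2 := by positivity
  have h := two_rpow_mul_rpow_le (α := α) (R := R) (by linarith) (t := √(1 + ‖x‖ ^ 2))
    (Real.le_sqrt_of_sq_le (by nlinarith))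
    (Real.sqrt_le_iff.2 ⟨by linarith, by nlinarith [norm_nonneg x]⟩)
  rw [Real.sqrt_eq_rpow, ← Real.rpow_mul ht.le, show 1 / 2 * -α = -(α / 2) by ring] at h
  rw [mul_assoc]
  exact mul_le_mul_of_nonneg_left h hK.le

/-- Localised maximum principle: a solution of growth `σ` whose tail integrals have order `e`
is bounded above at infinity by powers improved by the order of the equation. -/
theorem exists_le_rpow_of_growth (hN : 1 ≤ N) (hs0 : 0 < s) (hs1 : s < 1)
    {V : EuclideanSpace ℝ (Fin N) → ℝ} {K α σ C D e : ℝ} (hu : Continuous u) (hK : 0 < K)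
    (hV : ∀ x, K * (1 + ‖x‖ ^ 2) ^ (-(α / 2)) ≤ V x)
    (heq : ∀ x, ∃ h : ℝ, HasFracLaplacianAt N s u x h ∧ h + V x * u x = 0)
    (hσ : 0 < σ) (hC : 0 < C) (hgrowth : ∀ x, |u x| ≤ C * (1 + ‖x‖ ^ 2) ^ (σ / 2)) (hD : 0 ≤ D)
    (htail : ∀ (x : EuclideanSpace ℝ (Fin N)) (r : ℝ), 1 ≤ r → ‖x‖ ≤ 5 * r →
      IntegrableOn (fun y => |u y| / ‖x - y‖ ^ ((N : ℝ) + 2 * s)) (ball x r)ᶜ ∧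
      ∫ y in (ball x r)ᶜ, |u y| / ‖x - y‖ ^ ((N : ℝ) + 2 * s) ≤ D * r ^ e) :
    ∃ B : ℝ, ∀ x, 4 ≤ ‖x‖ → u x ≤ B * (‖x‖ ^ (σ - 2 * s + α) + ‖x‖ ^ (e + α)) := by
  have hκ0 : 0 ≤ ∫ z in ball (0 : EuclideanSpace ℝ (Fin N)) 1, ‖z‖ ^ (2 - ((N : ℝ) + 2 * s)) :=
    integral_nonneg fun z => by positivity
  have hc := fracConst_pos (N := N) hs0 hs1
  have htouching := fun (x w : EuclideanSpace ℝ (Fin N)) (A F r h : ℝ) =>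
    HasFracLaplacianAt.ge_of_touching (u := u) (x := x) (w := w) (A := A) (F := F) (r := r)
      (h := h) hN hs0 hs1
  -- From here on only the signs of this integral and of `fracConst` matter.
  generalize (∫ z in ball (0 : EuclideanSpace ℝ (Fin N)) 1, ‖z‖ ^ (2 - ((N : ℝ) + 2 * s))) = κ
    at hκ0 htouching
  generalize fracConst N s = c at hc htouching
  obtain ⟨c₁, hc₁⟩ : ∃ c₁ : ℝ, c₁ = 16 * (C * 2 ^ σ) * (1 / 4) ^ (2 - 2 * s) * κ := ⟨_, rfl⟩
  obtain ⟨c₂, hc₂⟩ : ∃ c₂ : ℝ, c₂ = D * (1 / 4) ^ e := ⟨_, rfl⟩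
  have hc₁0 : 0 ≤ c₁ := by rw [hc₁]; positivity
  have hc₂0 : 0 ≤ c₂ := by rw [hc₂]; positivity
  refine ⟨c * (c₁ + c₂) / (K * 2 ^ (-|α|)), fun x₀ hx₀ => ?_⟩
  obtain ⟨R, hR⟩ : ∃ R : ℝ, R = ‖x₀‖ := ⟨_, rfl⟩
  rw [← hR] at hx₀ ⊢
  have hR0 : 0 < R := by linarith
  rcases le_or_gt (u x₀) 0 with hu0 | hu0
  · exact hu0.trans (by positivity)
  have hbound : ∀ y ∈ closedBall x₀ (R / 2), u y ≤ C * 2 ^ σ * R ^ σ := fun y hy => by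
    have h1 : ‖y - x₀‖ ≤ R / 2 := by simpa [dist_eq_norm] using hy
    have := norm_sub_norm_le y x₀
    exact le_of_growth_of_norm_le hσ hC (by linarith) hgrowth (by linarith)
  obtain ⟨x₁, hclose, hu1, htouch⟩ :=
    exists_touching_paraboloid hu hR0 (by positivity) hu0 hbound
  have hx₁le : ‖x₁‖ ≤ 5 * (R / 4) := by
    have := norm_sub_norm_le x₁ x₀
    linarith
  have hx₁ge : 3 * R / 4 ≤ ‖x₁‖ := by
    have := norm_sub_norm_le x₀ x₁
    rw [norm_sub_rev] at this
    linarith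
  -- The condition `4 ≤ ‖x₀‖` makes the touching radius `R / 4` at least `1`.
  obtain ⟨hI, hF⟩ := htail x₁ (R / 4) (by linarith) hx₁le
  obtain ⟨h, hh, hh0⟩ := heq x₁
  have key := htouching _ _ _ _ _ _ hh (by positivity) (by positivity) (hu0.le.trans hu1)
    htouch hI hF
  have e1 : 16 * (C * 2 ^ σ * R ^ σ) / R ^ 2 * ((R / 4) ^ (2 - 2 * s) * κ) =
      c₁ * R ^ (σ - 2 * s) := by
    rw [hc₁, div_eq_mul_one_div R 4, Real.mul_rpow hR0.le (by norm_num),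
      Real.rpow_sub hR0 2, Real.rpow_sub hR0 σ, Real.rpow_two]
    field_simp
  have e2 : D * (R / 4) ^ e = c₂ * R ^ e := by
    rw [hc₂, div_eq_mul_one_div R 4, Real.mul_rpow hR0.le (by norm_num)]
    ring
  rw [e1, e2] at key
  have hVx := mul_rpow_le_of_norm hK hV hx₀ hx₁ge hx₁le
  have hP1 : 0 < R ^ (σ - 2 * s) := by positivity
  have hP2 : 0 < R ^ e := by positivity
  have hP3 : 0 < R ^ (-α) := by positivity
  have h2 : (0 : ℝ) < 2 ^ (-|α|) := by positivity
  have hmain : K * 2 ^ (-|α|) * R ^ (-α) * u x₀ ≤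
      c * ((c₁ + c₂) * (R ^ (σ - 2 * s) + R ^ e)) := by
    calc K * 2 ^ (-|α|) * R ^ (-α) * u x₀ ≤ V x₁ * u x₁ :=
          mul_le_mul hVx hu1 hu0.le (le_trans (by positivity) hVx)
      _ ≤ c * (c₁ * R ^ (σ - 2 * s) + c₂ * R ^ e) := by linarith
      _ ≤ _ := by
        gcongr
        nlinarith [mul_nonneg hc₁0 hP2.le, mul_nonneg hc₂0 hP1.le]
  rw [Real.rpow_add hR0, Real.rpow_add hR0, ← add_mul, div_mul_eq_mul_div,
    le_div_iff₀ (by positivity)]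
  have hinv : R ^ (-α) * R ^ α = 1 := by rw [← Real.rpow_add hR0]; simp
  have h3 := mul_le_mul_of_nonneg_right hmain (show 0 ≤ R ^ α by positivity)
  calc u x₀ * (K * 2 ^ (-|α|)) = K * 2 ^ (-|α|) * u x₀ * (R ^ (-α) * R ^ α) := by rw [hinv]; ring
    _ ≤ _ := by linarith

/-- A function tending to nonpositive values at infinity and satisfying the equation at its
positive maxima is nonpositive. -/
theorem nonpos_of_decay (hs0 : 0 < s) (hs1 : s < 1) {V : EuclideanSpace ℝ (Fin N) → ℝ}
    (hu : Continuous u) (hV : ∀ x, 0 < V x)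
    (heq : ∀ x, ∃ h : ℝ, HasFracLaplacianAt N s u x h ∧ h + V x * u x = 0)
    {B a b : ℝ} (ha : a < 0) (hb : b < 0)
    (hdecay : ∀ x, 4 ≤ ‖x‖ → u x ≤ B * (‖x‖ ^ a + ‖x‖ ^ b)) (x : EuclideanSpace ℝ (Fin N)) :
    u x ≤ 0 := by
  by_contra! hx
  have hlim : Tendsto (fun t : ℝ => B * (t ^ a + t ^ b)) atTop (𝓝 0) := by
    have h1 := tendsto_rpow_neg_atTop (neg_pos.2 ha)
    have h2 := tendsto_rpow_neg_atTop (neg_pos.2 hb)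
    simpa using (h1.add h2).const_mul B
  have hev : ∀ᶠ y in cocompact (EuclideanSpace ℝ (Fin N)), u y ≤ u x := by
    have hnorm := tendsto_norm_cocompact_atTop (E := EuclideanSpace ℝ (Fin N))
    filter_upwards [hnorm.eventually (hlim.eventually (ge_mem_nhds hx)),
      hnorm.eventually (eventually_ge_atTop 4)] with y hy hy4
    exact (hdecay y hy4).trans hy
  -- Outside a compact set `u ≤ u x`, so a global maximum is attained, and it is positive.
  obtain ⟨x₁, hx₁⟩ := hu.exists_forall_ge' x hev
  obtain ⟨h, hh, hh0⟩ := heq x₁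
  have h1 := hh.nonneg_of_isMax hs0 hs1 hx₁
  have h2 := mul_pos (hV x₁) (hx.trans_le (hx₁ x))
  linarith

end Liouville

end FracElliptic

/-! ### The Liouville theorem. -/

theorem corollary2p9 (N : ℕ) (hN : 1 ≤ N) (s : ℝ) (hs0 : 0 < s) (hs1 : s < 1)
    (α : ℝ) (hα : α < 2 * s) :
    ∃ Λ : ℝ, ∀ (ρ c u : EuclideanSpace ℝ (Fin N) → ℝ) (K c₀ p σ C : ℝ),
      Continuous ρ → (∀ x, 0 < ρ x) →
      0 < K → (∀ x, K * (1 + ‖x‖ ^ 2) ^ (-(α / 2)) ≤ ρ x) →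
      Continuous c → (∀ x, 0 ≤ c x) →
      0 < c₀ → (∀ x, c₀ ≤ c x) →
      FracElliptic.IsSolution N s ρ c u →
      1 ≤ p → FracElliptic.MemLs N s (fun x => |u x| ^ p) →
      Λ < p * c₀ * K →
      0 < σ → σ < 2 * s - α → 0 < C →
      (∀ x, |u x| ≤ C * (1 + ‖x‖ ^ 2) ^ (σ / 2)) →
      ∀ x, u x = 0 := by
  -- The growth condition alone forces decay of `u` at infinity, so `Λ = 0` is admissible.
  refine ⟨0, fun ρ c u K c₀ p σ C _ hρ hK hKρ _ _ hc₀ hc hsol _ _ _ hσ0 hσ hC hgrowth => ?_⟩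
  have hcont := hsol.regular.continuous hs0
  have hV : ∀ x, K * c₀ * (1 + ‖x‖ ^ 2) ^ (-(α / 2)) ≤ ρ x * c x := fun x => by
    have h := mul_le_mul (hKρ x) (hc x) hc₀.le (hρ x).le
    linarith
  have hVpos : ∀ x, 0 < ρ x * c x := fun x => mul_pos (hρ x) (hc₀.trans_le (hc x))
  obtain ⟨D, e, hD, he, htail⟩ : ∃ D e : ℝ, 0 ≤ D ∧ e + α < 0 ∧
      ∀ (x : EuclideanSpace ℝ (Fin N)) (r : ℝ), 1 ≤ r → ‖x‖ ≤ 5 * r →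
      IntegrableOn (fun y => |u y| / ‖x - y‖ ^ ((N : ℝ) + 2 * s)) (Metric.ball x r)ᶜ ∧
      ∫ y in (Metric.ball x r)ᶜ, |u y| / ‖x - y‖ ^ ((N : ℝ) + 2 * s) ≤ D * r ^ e := by
    -- For `α < 0`, `σ` may reach `2 * s` and the growth bound need not control the tail; membership
    -- in `𝓛ˢ` bounds it, and `e = 0` suffices. For `α ≥ 0`, `σ < 2 * s` and growth gives `e = σ - 2
    -- * s`.
    rcases lt_or_ge α 0 with hα0 | hα0
    · refine ⟨(1 + 6 ^ ((N : ℝ) + 2 * s)) * ∫ y, |u y| / (1 + ‖y‖ ^ ((N : ℝ) + 2 * s)), 0,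
        mul_nonneg (by positivity) (integral_nonneg fun y => by positivity),
        by linarith, fun x r hr hx => ?_⟩
      rw [Real.rpow_zero, mul_one]
      exact hsol.memLs.tail_le hs0 hr hx
    · refine ⟨C * 7 ^ σ * ∫ z in (Metric.ball (0 : EuclideanSpace ℝ (Fin N)) 1)ᶜ,
        ‖z‖ ^ (σ - ((N : ℝ) + 2 * s)), σ - 2 * s, ?_, by linarith, fun x r hr hx =>
        FracElliptic.tail_le_of_growth hN hsol.memLs.1 hσ0 (by linarith) hC hgrowth hr hx⟩
      exact mul_nonneg (by positivity) (integral_nonneg fun y => by positivity)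
  have heq_neg : ∀ x, ∃ h : ℝ, FracElliptic.HasFracLaplacianAt N s (fun y => -u y) x h ∧
      h + ρ x * c x * -u x = 0 := fun x => by
    obtain ⟨h, hh, hh0⟩ := hsol.equation x
    exact ⟨-h, hh.neg, by linarith⟩
  obtain ⟨B₁, hB₁⟩ := FracElliptic.exists_le_rpow_of_growth hN hs0 hs1 hcont (mul_pos hK hc₀) hV
    hsol.equation hσ0 hC hgrowth hD htail
  obtain ⟨B₂, hB₂⟩ := FracElliptic.exists_le_rpow_of_growth (u := fun y => -u y) hN hs0 hs1
    hcont.neg (mul_pos hK hc₀) hV heq_neg hσ0 hC (by simpa only [abs_neg] using hgrowth) hD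
    (by simpa only [abs_neg] using htail)
  intro x
  have h1 := FracElliptic.nonpos_of_decay hs0 hs1 hcont hVpos hsol.equation
    (by linarith) he hB₁ x
  have h2 := FracElliptic.nonpos_of_decay (u := fun y => -u y) hs0 hs1 hcont.neg hVpos heq_neg
    (by linarith) he hB₂ x
  linarith
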